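/- Let $n\ge 1$. A star body (about the origin) is a compact set $K\subset\mathbb R^n$ with $o\in\operatorname{int}K$ that is star-shaped with respect to the origin $o$ ($\lambda x\in K$ whenever $x\in K$, $0\le\lambda\le1$) and whose radial function $\rho_K(u)=\sup\{\lambda\ge 0:\lambda u\in K\}$ is continuous on the unit sphere $S^{n-1}$. Let $\Phi$ be the class of convex, strictly increasing functions $\varphi:[0,\infty)\to[0,\infty)$ with $\varphi(0)=0$. For star bodies $K,L$ and $\varphi\in\Phi$ put $$O_\varphi(K,L)=\inf\Big\{\lambda>0:\ \frac1{V(K)}\int_{S^{n-1}}\varphi\Big(\frac{\rho_K}{\lambda\rho_L}\Big)\,\frac{\rho_K^n}{n}\,dS\le\varphi(1)\Big\},$$ where $V$ is volume and $S$ is spherical Lebesgue measure. Ellipsoids are understood to be non-degenerate. The Orlicz-Legendre ellipsoid $\mathrm L_\varphi K$ is the unique ellipsoid of minimal volume among all origin-symmetric ellipsoids $E$ with $O_\varphi(K,E)\le1$. For a convex body $Q$ containing $o$ in its interior, let $\mathrm E_\infty Q$ be the unique origin-symmetric ellipsoid of maximal volume contained in $Q$, let $Q^*=\{x: x\cdot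 y\le 1\text{ for all }y\in Q\}$ be its polar, and define $\mathrm L_\infty K=\big(\mathrm E_\infty(\operatorname{conv}K)^*\big)^*$. **Theorem 6.4.** Let $K$ be a star body in $\mathbb R^n$ and let $\varphi\in\Phi$. Then $\mathrm L_{\varphi^p}K$ is well defined for every real $p\ge1$ (that is, the minimization problem defining it has exactly one solution), and $$\lim_{p\to\infty}\mathrm L_{\varphi^p}K=\mathrm L_\infty K,$$ both in the Hausdorff metric and in the dual Hausdorff metric $\tilde\delta_H(K_1,K_2)=\max_{u\in S^{n-1}}|\rho_{K_1}(u)-\rho_{K_2}(u)|$. Here $\mathrm L_\infty K$ is the unique ellipsoid of minimal volume among all origin-symmetric ellipsoids containing $K$; if $K$ is origin-symmetric, then $\mathrm L_\infty K$ is the Löwner ellipsoid of $K$, i.e. the unique ellipsoid of minimal volume among all ellipsoids (with arbitrary center) containing $K$. -/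

import Mathlib

open MeasureTheory Filter Topology
open scoped Pointwise

noncomputable section

namespace OrliczLegendre

/-- Euclidean `n`-space. -/
abbrev Euc (n : ℕ) : Type := EuclideanSpace ℝ (Fin n)

/-- The unit sphere of Euclidean `n`-space. -/
abbrev USphere (n : ℕ) : Type := Metric.sphere (0 : Euc n) 1

/-- The class `Φ` of convex, strictly increasing functions on `[0, ∞)` that vanish at `0`.  Such a
function is nonnegative on `[0, ∞)`; its values at negative arguments play no role. -/
structure MemPhi (φ : ℝ → ℝ) : Prop where
  convexOn : ConvexOn ℝ (Set.Ici 0) φ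
  strictMonoOn : StrictMonoOn φ (Set.Ici 0)
  map_zero : φ 0 = 0

/-- The radial function `ρ_K(x) = sup {t ≥ 0 : t x ∈ K}`. -/
def radial {n : ℕ} (K : Set (Euc n)) (x : Euc n) : ℝ :=
  sSup {t : ℝ | 0 ≤ t ∧ t • x ∈ K}

/-- Star bodies about the origin: compact sets, star-shaped with respect to the origin, with the
origin in the interior and with a radial function that is continuous on the unit sphere. -/
structure IsStarBody {n : ℕ} (K : Set (Euc n)) : Prop where
  isCompact : IsCompact K
  starConvex : StarConvex ℝ 0 K
  zero_mem_interior : (0 : Euc n) ∈ interior K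
  continuousOn_radial : ContinuousOn (radial K) (Metric.sphere (0 : Euc n) 1)

/-- Nondegenerate ellipsoids with arbitrary center `c`. -/
def IsEllipsoid {n : ℕ} (E : Set (Euc n)) : Prop :=
  ∃ (c : Euc n) (T : Euc n ≃L[ℝ] Euc n), E = (fun x => c + T x) '' Metric.closedBall 0 1

/-- Nondegenerate origin-symmetric ellipsoids. -/
def IsCenteredEllipsoid {n : ℕ} (E : Set (Euc n)) : Prop :=
  ∃ T : Euc n ≃L[ℝ] Euc n, E = T '' Metric.closedBall 0 1

/-- The dual conical measure of `K`, with density `ρ_K ^ n / n` with respect to the spherical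
Lebesgue measure. -/
def dualConicalMeasure {n : ℕ} (K : Set (Euc n)) : Measure (USphere n) :=
  (volume : Measure (Euc n)).toSphere.withDensity
    fun u => ENNReal.ofReal (radial K u ^ n / n)

/-- The Orlicz norm of `f` with respect to `μ`: the infimum of all `t > 0` such that
`(1 / |μ|) ∫ φ (f / t) dμ ≤ φ 1`. -/
def orliczNorm {n : ℕ} (φ : ℝ → ℝ) (μ : Measure (USphere n)) (f : USphere n → ℝ) : ℝ :=
  sInf {t : ℝ | 0 < t ∧ (μ.real Set.univ)⁻¹ * ∫ u, φ (f u / t) ∂μ ≤ φ 1}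

/-- `O_φ(K, L)`: the Orlicz norm of `ρ_K / ρ_L` with respect to the dual conical measure of `K`. -/
def orliczO {n : ℕ} (φ : ℝ → ℝ) (K L : Set (Euc n)) : ℝ :=
  orliczNorm φ (dualConicalMeasure K) fun u => radial K u / radial L u

/-- `L` belongs to the class `C` and every other member of `C` has strictly larger volume. -/
def IsUniqueVolumeMin {n : ℕ} (C : Set (Set (Euc n))) (L : Set (Euc n)) : Prop :=
  L ∈ C ∧ ∀ E ∈ C, E ≠ L → volume L < volume E

/-- `L` belongs to the class `C` and every other member of `C` has strictly smaller volume. -/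
def IsUniqueVolumeMax {n : ℕ} (C : Set (Set (Euc n))) (L : Set (Euc n)) : Prop :=
  L ∈ C ∧ ∀ E ∈ C, E ≠ L → volume E < volume L

/-- The origin-symmetric ellipsoids `E` with `O_φ(K, E) ≤ 1`. -/
def orliczFeasible {n : ℕ} (φ : ℝ → ℝ) (K : Set (Euc n)) : Set (Set (Euc n)) :=
  {E | IsCenteredEllipsoid E ∧ orliczO φ K E ≤ 1}

/-- The Orlicz-Legendre ellipsoid `L_φ K`: the unique origin-symmetric ellipsoid of minimal volume
subject to `O_φ(K, E) ≤ 1` (an arbitrary set if there were no such ellipsoid). -/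
def orliczLegendre {n : ℕ} (φ : ℝ → ℝ) (K : Set (Euc n)) : Set (Euc n) :=
  Classical.epsilon (IsUniqueVolumeMin (orliczFeasible φ K))

/-- The polar set `{x : x ⬝ y ≤ 1 for all y ∈ K}`. -/
def polarSet {n : ℕ} (K : Set (Euc n)) : Set (Euc n) :=
  {x | ∀ y ∈ K, inner ℝ x y ≤ 1}

/-- The ellipsoid `E_∞ Q`: the unique origin-symmetric ellipsoid of maximal volume contained in `Q`
(an arbitrary set if there were no such ellipsoid). -/
def johnInfty {n : ℕ} (Q : Set (Euc n)) : Set (Euc n) :=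
  Classical.epsilon (IsUniqueVolumeMax {E | IsCenteredEllipsoid E ∧ E ⊆ Q})

/-- The ellipsoid `L_∞ K`: the polar of `E_∞` of the polar of the convex hull of `K`. -/
def legendreInfty {n : ℕ} (K : Set (Euc n)) : Set (Euc n) :=
  polarSet (johnInfty (polarSet (convexHull ℝ K)))

/-- The dual Hausdorff (radial) distance, i.e. the maximum of `|ρ_K - ρ_L|` over the sphere. -/
def dualHausdorffDist {n : ℕ} (K L : Set (Euc n)) : ℝ :=
  ⨆ u : USphere n, |radial K u - radial L u|

end OrliczLegendre

end

/-! Origin-symmetric ellipsoids are the sets `{x : |A x| ≤ 1}` with `A` positive definite, of volume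
proportional to `1 / det A`. Minimizing volume therefore means maximizing `det A`. Put `x(u) =
ρ_K(u) u` and let `μ` be the dual conical measure. The constraint `O_φ(K, E) ≤ 1` becomes `∫ φ(|A
x(u)|) dμ ≤ |μ| φ(1)` (`MemPhi.orliczO_ellipsoid_le_one_iff`), and `K ⊆ E` becomes `|A x(u)| ≤ 1`
for all `u`. Both are closed convex conditions on `A` and both bound `A`, so compactness gives a
maximizer and strict log-concavity of the determinant makes it unique
(`exists_det_lt_of_isCompact`).

For the limit, the bound in `exists_norm_le` does not depend on `φ`, so the maximizers for `φ ^ p`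
stay in one compact set. The maximizer `A` for inclusion is feasible for every `p`, hence their
determinants are at least `det A`. A cluster point satisfies `|B x(u)| ≤ 1`, since otherwise `φ ^ p`
would exceed the constraint exponentially on an open set. Uniqueness forces `B = A`
(`MemPhi.tendsto_feasible_max`). Matrix convergence gives convergence in both metrics, and polarity
identifies the limit with `L_∞ K` (`legendreInfty_eq`). -/

noncomputable section

namespace OrliczLegendre

open Matrix
open scoped Matrix.Norms.L2Operator MatrixOrder

/-! ### Strict log-concavity of the determinant -/

section Determinant

variable {ι : Type*} [Fintype ι] [DecidableEq ι]

lemma exists_posDef_mul_self {A : Matrix ι ι ℝ} (hA : A.PosDef) :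
    ∃ S : Matrix ι ι ℝ, S.PosDef ∧ S * S = A := by
  have h : CFC.sqrt A * CFC.sqrt A = A := CFC.sqrt_mul_sqrt_self A hA.posSemidef.nonneg
  have hS : (CFC.sqrt A).PosSemidef := (CFC.sqrt_nonneg A).posSemidef
  refine ⟨_, hS.posDef_iff_det_ne_zero.2 fun h0 => hA.det_pos.ne' ?_, h⟩
  rw [← h, det_mul, h0, mul_zero]

lemma det_half_one_add {C : Matrix ι ι ℝ} (hC : C.IsHermitian) :
    ((1 / 2 : ℝ) • (1 + C)).det = ∏ i, (1 + hC.eigenvalues i) / 2 := by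
  set U : Matrix ι ι ℝ := (hC.eigenvectorUnitary : Matrix ι ι ℝ)
  have hU : U * star U = 1 := Unitary.mul_star_self_of_mem hC.eigenvectorUnitary.2
  have hC' : C = U * diagonal hC.eigenvalues * star U := by
    have := hC.spectral_theorem
    rw [Unitary.conjStarAlgAut_apply] at this
    exact this
  have h : (1 / 2 : ℝ) • (1 + C) =
      U * diagonal (fun i => (1 + hC.eigenvalues i) / 2) * star U := by
    have hd : diagonal (fun i => (1 + hC.eigenvalues i) / 2) =
        (1 / 2 : ℝ) • (1 + diagonal hC.eigenvalues) := by
      ext i j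
      by_cases hij : i = j
      · subst hij; simp; ring
      · simp [hij]
    rw [hd, Matrix.mul_smul, Matrix.smul_mul, mul_add, add_mul, mul_one, hU, ← hC']
  rw [h, det_mul, det_mul, det_diagonal, mul_right_comm, ← det_mul, hU, det_one, one_mul]

/-- Eigenvalue by eigenvalue this is `t ≤ ((1 + t) / 2) ^ 2`, strict unless `t = 1`; if all
eigenvalues were `1`, then `C` would be the identity. -/
lemma det_lt_sq_det_half_one_add {C : Matrix ι ι ℝ} (hC : C.PosDef) (h1 : C ≠ 1) :
    C.det < ((1 / 2 : ℝ) • (1 + C)).det ^ 2 := by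
  rw [det_half_one_add hC.1, hC.1.det_eq_prod_eigenvalues, ← Finset.prod_pow]
  obtain ⟨i, hi⟩ : ∃ i, hC.1.eigenvalues i ≠ 1 := by
    by_contra! h
    apply h1
    have := hC.1.spectral_theorem
    rw [show (RCLike.ofReal ∘ hC.1.eigenvalues : ι → ℝ) = fun _ => 1 by
      ext i; simp [h i], diagonal_one, map_one] at this
    exact this
  refine Finset.prod_lt_prod (fun i _ => by simpa using hC.eigenvalues_pos i)
    (fun j _ => ?_) ⟨i, Finset.mem_univ _, ?_⟩
  · simp only [RCLike.ofReal_real_eq_id, id]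
    nlinarith [sq_nonneg (hC.1.eigenvalues j - 1)]
  · simp only [RCLike.ofReal_real_eq_id, id]
    have : 0 < (hC.1.eigenvalues i - 1) ^ 2 := by
      have := sub_ne_zero.2 hi
      positivity
    nlinarith

/-- Congruence by the square root `S` of `A` turns the pair `A, B` into `1, C` and multiplies both
sides by `det S ^ 4`. -/
lemma det_mul_det_lt_sq_det_midpoint {A B : Matrix ι ι ℝ} (hA : A.PosDef) (hB : B.PosDef)
    (hAB : A ≠ B) : A.det * B.det < ((1 / 2 : ℝ) • (A + B)).det ^ 2 := by
  obtain ⟨S, hS, rfl⟩ := exists_posDef_mul_self hA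
  have hu : IsUnit S.det := hS.det_pos.ne'.isUnit
  set C := S⁻¹ * B * S⁻¹ with hCdef
  have hC : C.PosDef := by
    have := hB.conjTranspose_mul_mul_same (B := S⁻¹)
      (mulVec_injective_iff_isUnit.2 hS.inv.isUnit)
    rwa [hS.inv.1] at this
  have hB' : B = S * C * S := by
    rw [hCdef]
    simp only [Matrix.mul_assoc, nonsing_inv_mul _ hu, mul_one]
    rw [← Matrix.mul_assoc, mul_nonsing_inv _ hu, one_mul]
  have hC1 : C ≠ 1 := by
    intro h
    rw [h, mul_one] at hB'
    exact hAB hB'.symm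
  have hM : (1 / 2 : ℝ) • (S * S + B) = S * ((1 / 2 : ℝ) • (1 + C)) * S := by
    rw [Matrix.mul_smul, Matrix.smul_mul, mul_add, add_mul, mul_one, ← hB']
  have := det_lt_sq_det_half_one_add hC hC1
  rw [hM, hB']
  simp only [det_mul]
  have hp : 0 < S.det ^ 4 := pow_pos hS.det_pos 4
  nlinarith [mul_lt_mul_of_pos_left this hp]

omit [DecidableEq ι] in
lemma isClosed_setOf_posSemidef : IsClosed {A : Matrix ι ι ℝ | A.PosSemidef} := by
  have : {A : Matrix ι ι ℝ | A.PosSemidef} =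
      {A | Aᴴ = A} ∩ ⋂ x : ι → ℝ, {A | 0 ≤ star x ⬝ᵥ (A *ᵥ x)} := by
    ext A
    simp [posSemidef_iff_dotProduct_mulVec, IsHermitian]
  rw [this]
  refine IsClosed.inter (isClosed_eq (by fun_prop) continuous_id) (isClosed_iInter fun x => ?_)
  exact isClosed_le continuous_const (by fun_prop)

/-- A compact convex set of positive semidefinite matrices which contains a positive definite
matrix has a unique element of maximal determinant. -/
lemma exists_det_lt_of_isCompact {C : Set (Matrix ι ι ℝ)} (hc : IsCompact C)
    (hconv : Convex ℝ C) (hpsd : ∀ A ∈ C, A.PosSemidef) (hne : ∃ A ∈ C, A.PosDef) :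
    ∃ A ∈ C, A.PosDef ∧ ∀ B ∈ C, B ≠ A → B.det < A.det := by
  obtain ⟨A₀, hA₀, hA₀p⟩ := hne
  obtain ⟨A, hA, hmax⟩ := hc.exists_isMaxOn ⟨A₀, hA₀⟩
    (Continuous.matrix_det continuous_id).continuousOn
  have hdet : 0 < A.det := hA₀p.det_pos.trans_le (hmax hA₀)
  have hAp : A.PosDef := (hpsd A hA).posDef_iff_det_ne_zero.2 hdet.ne'
  refine ⟨A, hA, hAp, fun B hB hBA => lt_of_le_of_ne (hmax hB) fun h => ?_⟩
  have hBp : B.PosDef := (hpsd B hB).posDef_iff_det_ne_zero.2 (by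
    have h' : B.det = A.det := h
    rw [h']; exact hdet.ne')
  have h1 := det_mul_det_lt_sq_det_midpoint hAp hBp hBA.symm
  have hM : (1 / 2 : ℝ) • (A + B) ∈ C := by
    rw [smul_add]
    exact hconv hA hB (by norm_num) (by norm_num) (by norm_num)
  have h2 : ((1 / 2 : ℝ) • (A + B)).det ≤ A.det := hmax hM
  have h3 : 0 ≤ ((1 / 2 : ℝ) • (A + B)).det := (hpsd _ hM).det_nonneg
  have h4 : B.det = A.det := h
  rw [h4] at h1
  nlinarith

end Determinant

/-! ### Ellipsoids as positive definite matrices, polarity, the Löwner ellipsoid -/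

section Ellipsoid

variable {n : ℕ}

/-- The action of a matrix on Euclidean space. -/
def act (A : Matrix (Fin n) (Fin n) ℝ) : Euc n →L[ℝ] Euc n :=
  toEuclideanCLM (n := Fin n) (𝕜 := ℝ) A

lemma act_add (A B : Matrix (Fin n) (Fin n) ℝ) : act (A + B) = act A + act B :=
  map_add (toEuclideanCLM (n := Fin n) (𝕜 := ℝ)) A B

lemma act_sub (A B : Matrix (Fin n) (Fin n) ℝ) : act (A - B) = act A - act B :=
  map_sub (toEuclideanCLM (n := Fin n) (𝕜 := ℝ)) A B

lemma act_smul (r : ℝ) (A : Matrix (Fin n) (Fin n) ℝ) : act (r • A) = r • act A :=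
  map_smul (toEuclideanCLM (n := Fin n) (𝕜 := ℝ)) r A

lemma act_one : act (1 : Matrix (Fin n) (Fin n) ℝ) = 1 :=
  map_one (toEuclideanCLM (n := Fin n) (𝕜 := ℝ))

lemma act_mul_apply (A B : Matrix (Fin n) (Fin n) ℝ) (x : Euc n) :
    act (A * B) x = act A (act B x) := by
  have : act (A * B) = act A * act B := map_mul (toEuclideanCLM (n := Fin n) (𝕜 := ℝ)) A B
  rw [this]; rfl

lemma norm_act (A : Matrix (Fin n) (Fin n) ℝ) : ‖act A‖ = ‖A‖ := rfl

lemma norm_act_apply_le (A : Matrix (Fin n) (Fin n) ℝ) (x : Euc n) :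
    ‖act A x‖ ≤ ‖A‖ * ‖x‖ := (act A).le_opNorm x

lemma continuous_act : Continuous (act (n := n)) := by
  refine AddMonoidHomClass.continuous_of_bound (toEuclideanCLM (n := Fin n) (𝕜 := ℝ)) 1
    fun A => ?_
  rw [one_mul]; exact (norm_act A).le

lemma act_conjTranspose (A : Matrix (Fin n) (Fin n) ℝ) :
    act Aᴴ = ContinuousLinearMap.adjoint (act A) :=
  map_star (toEuclideanCLM (n := Fin n) (𝕜 := ℝ)) A

lemma norm_act_apply_sq (A : Matrix (Fin n) (Fin n) ℝ) (x : Euc n) :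
    ‖act A x‖ ^ 2 = inner ℝ (act (Aᴴ * A) x) x := by
  rw [act_mul_apply, act_conjTranspose, ContinuousLinearMap.adjoint_inner_left,
    real_inner_self_eq_norm_sq]

lemma inner_act_left {A : Matrix (Fin n) (Fin n) ℝ} (hA : A.IsHermitian) (x y : Euc n) :
    inner ℝ (act A x) y = inner ℝ x (act A y) := by
  rw [← ContinuousLinearMap.adjoint_inner_left, ← act_conjTranspose, hA]

lemma act_inv_act {A : Matrix (Fin n) (Fin n) ℝ} (hA : A.PosDef) (x : Euc n) :
    act A⁻¹ (act A x) = x := by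
  rw [← act_mul_apply, nonsing_inv_mul _ hA.det_pos.ne'.isUnit, act_one]; rfl

lemma act_act_inv {A : Matrix (Fin n) (Fin n) ℝ} (hA : A.PosDef) (x : Euc n) :
    act A (act A⁻¹ x) = x := by
  rw [← act_mul_apply, mul_nonsing_inv _ hA.det_pos.ne'.isUnit, act_one]; rfl

lemma norm_act_apply_pos {A : Matrix (Fin n) (Fin n) ℝ} (hA : A.PosDef) {x : Euc n}
    (hx : x ≠ 0) : 0 < ‖act A x‖ := by
  refine norm_pos_iff.2 fun h => hx ?_
  rw [← act_inv_act hA x, h, map_zero]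

lemma det_act (A : Matrix (Fin n) (Fin n) ℝ) :
    LinearMap.det (act A : Euc n →ₗ[ℝ] Euc n) = A.det := by
  have : (act A : Euc n →ₗ[ℝ] Euc n) = Matrix.toLin (EuclideanSpace.basisFun (Fin n) ℝ).toBasis
      (EuclideanSpace.basisFun (Fin n) ℝ).toBasis A := by
    rw [act, coe_toEuclideanCLM_eq_toEuclideanLin, toEuclideanLin_eq_toLin_orthonormal]
  rw [this, LinearMap.det_toLin]

/-- The ellipsoid `{x : |A x| ≤ 1}`. -/
def ellipsoid (A : Matrix (Fin n) (Fin n) ℝ) : Set (Euc n) := {x | ‖act A x‖ ≤ 1}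

lemma ellipsoid_eq_image {A : Matrix (Fin n) (Fin n) ℝ} (hA : A.PosDef) :
    ellipsoid A = act A⁻¹ '' Metric.closedBall 0 1 := by
  ext x
  constructor
  · intro h
    exact ⟨act A x, by simpa [ellipsoid] using h, act_inv_act hA x⟩
  · rintro ⟨y, hy, rfl⟩
    simpa [ellipsoid, act_act_inv hA] using hy

lemma isCenteredEllipsoid_ellipsoid {A : Matrix (Fin n) (Fin n) ℝ} (hA : A.PosDef) :
    IsCenteredEllipsoid (ellipsoid A) :=
  ⟨ContinuousLinearEquiv.equivOfInverse (act A⁻¹) (act A) (act_act_inv hA) (act_inv_act hA),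
    ellipsoid_eq_image hA⟩

/-- Polar decomposition: if `M` is the matrix of `T⁻¹`, then `|M x| = |S x|` for the square root `S`
of `Mᴴ M`. -/
lemma IsCenteredEllipsoid.exists_eq_ellipsoid {E : Set (Euc n)} (hE : IsCenteredEllipsoid E) :
    ∃ A : Matrix (Fin n) (Fin n) ℝ, A.PosDef ∧ E = ellipsoid A := by
  obtain ⟨T, rfl⟩ := hE
  obtain ⟨M, hM⟩ : ∃ M : Matrix (Fin n) (Fin n) ℝ, act M = (T.symm : Euc n →L[ℝ] Euc n) :=
    (toEuclideanCLM (n := Fin n) (𝕜 := ℝ)).surjective _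
  have hdet : M.det ≠ 0 := by
    rw [← det_act, hM]
    exact (LinearEquiv.isUnit_det' T.symm.toLinearEquiv).ne_zero
  have hpos : (Mᴴ * M).PosDef := PosDef.conjTranspose_mul_self M
    (mulVec_injective_iff_isUnit.2 ((isUnit_iff_isUnit_det M).2 hdet.isUnit))
  obtain ⟨S, hS, hSS⟩ := exists_posDef_mul_self hpos
  refine ⟨S, hS, ?_⟩
  have key : ∀ x, ‖act S x‖ = ‖T.symm x‖ := by
    intro x
    have h1 := norm_act_apply_sq S x
    have h2 := norm_act_apply_sq M x
    rw [hS.1, hSS, ← h2, hM] at h1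
    exact (sq_eq_sq₀ (norm_nonneg _) (norm_nonneg _)).1 h1
  ext x
  rw [ellipsoid, Set.mem_ofPred_eq, key]
  constructor
  · rintro ⟨y, hy, rfl⟩
    simpa using hy
  · intro h
    exact ⟨T.symm x, by simpa using h, by simp⟩

lemma volume_ellipsoid {A : Matrix (Fin n) (Fin n) ℝ} (hA : A.PosDef) :
    volume (ellipsoid A) =
      ENNReal.ofReal A.det⁻¹ * volume (Metric.closedBall (0 : Euc n) 1) := by
  have h : ellipsoid A = (act A : Euc n →ₗ[ℝ] Euc n) ⁻¹' Metric.closedBall 0 1 := by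
    ext x; simp [ellipsoid]
  rw [h, Measure.addHaar_preimage_linearMap _ (by rw [det_act]; exact hA.det_pos.ne'), det_act,
    abs_of_pos (inv_pos.2 hA.det_pos)]

lemma volume_ellipsoid_lt {A B : Matrix (Fin n) (Fin n) ℝ} (hA : A.PosDef) (hB : B.PosDef)
    (h : B.det < A.det) : volume (ellipsoid A) < volume (ellipsoid B) := by
  rw [volume_ellipsoid hA, volume_ellipsoid hB]
  refine ENNReal.mul_lt_mul_left ?_ ?_ ?_
  · exact (Metric.measure_closedBall_pos _ _ one_pos).ne'
  · exact measure_closedBall_lt_top.ne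
  · rw [ENNReal.ofReal_lt_ofReal_iff (inv_pos.2 hB.det_pos)]
    exact inv_strictAnti₀ hB.det_pos h

/-- Uniqueness of the determinant maximizer yields uniqueness of the ellipsoid of minimal
volume. -/
lemma isUniqueVolumeMin_ellipsoid {F : Set (Set (Euc n))} {C : Set (Matrix (Fin n) (Fin n) ℝ)}
    (hF : ∀ E ∈ F, IsCenteredEllipsoid E)
    (hFC : ∀ A : Matrix (Fin n) (Fin n) ℝ, A.PosDef → (ellipsoid A ∈ F ↔ A ∈ C))
    {A : Matrix (Fin n) (Fin n) ℝ} (hA : A.PosDef) (hAC : A ∈ C)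
    (hmax : ∀ B ∈ C, B ≠ A → B.det < A.det) : IsUniqueVolumeMin F (ellipsoid A) := by
  refine ⟨(hFC A hA).2 hAC, fun E hE hne => ?_⟩
  obtain ⟨B, hB, rfl⟩ := (hF E hE).exists_eq_ellipsoid
  exact volume_ellipsoid_lt hA hB (hmax B ((hFC B hB).1 hE) fun h => hne (by rw [h]))

lemma IsUniqueVolumeMin.eq {F : Set (Set (Euc n))} {L M : Set (Euc n)}
    (hL : IsUniqueVolumeMin F L) (hM : IsUniqueVolumeMin F M) : L = M := by
  by_contra h
  exact (hL.2 M hM.1 (Ne.symm h)).asymm (hM.2 L hL.1 h)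

lemma IsUniqueVolumeMax.eq {F : Set (Set (Euc n))} {L M : Set (Euc n)}
    (hL : IsUniqueVolumeMax F L) (hM : IsUniqueVolumeMax F M) : L = M := by
  by_contra h
  exact (hL.2 M hM.1 (Ne.symm h)).asymm (hM.2 L hL.1 h)

lemma radial_ellipsoid {A : Matrix (Fin n) (Fin n) ℝ} (hA : A.PosDef) {x : Euc n}
    (hx : x ≠ 0) : radial (ellipsoid A) x = ‖act A x‖⁻¹ := by
  have hp := norm_act_apply_pos hA hx
  have : {t : ℝ | 0 ≤ t ∧ t • x ∈ ellipsoid A} = Set.Icc 0 ‖act A x‖⁻¹ := by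
    ext t
    simp only [ellipsoid, Set.mem_ofPred_eq, Set.mem_Icc, map_smul, norm_smul, Real.norm_eq_abs]
    refine and_congr_right fun ht => ?_
    rw [abs_of_nonneg ht, ← one_div, le_div_iff₀ hp]
  rw [radial, this, csSup_Icc (inv_nonneg.2 hp.le)]

/-- By symmetry of `A`, the maximum of `⟨x, A y⟩` over the unit ball is `|A x|`, attained at the
normalized vector `A x`. -/
lemma polarSet_closedBall_image {A : Matrix (Fin n) (Fin n) ℝ} (hA : A.PosDef) :
    polarSet (act A '' Metric.closedBall 0 1) = ellipsoid A := by
  ext x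
  simp only [polarSet, ellipsoid, Set.mem_ofPred_eq, Set.forall_mem_image, ← inner_act_left hA.1,
    mem_closedBall_zero_iff]
  constructor
  · intro h
    by_cases h0 : act A x = 0
    · simp [h0]
    have hp : 0 < ‖act A x‖ := norm_pos_iff.2 h0
    have := @h (‖act A x‖⁻¹ • act A x) (by
      rw [norm_smul, norm_inv, norm_norm, inv_mul_cancel₀ hp.ne'])
    rw [inner_smul_right, real_inner_self_eq_norm_sq, sq, inv_mul_cancel_left₀ hp.ne'] at this
    exact this
  · intro h y hy
    calc inner ℝ (act A x) y ≤ ‖act A x‖ * ‖y‖ := real_inner_le_norm _ _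
      _ ≤ 1 := mul_le_one₀ h (norm_nonneg _) hy

lemma polarSet_ellipsoid {A : Matrix (Fin n) (Fin n) ℝ} (hA : A.PosDef) :
    polarSet (ellipsoid A) = ellipsoid A⁻¹ := by
  rw [ellipsoid_eq_image hA, polarSet_closedBall_image hA.inv]

/-- Polarity reverses inclusions and inverts the matrix, and the convex hull is harmless because
half-spaces are convex. This exchanges minimal circumscribed and maximal inscribed ellipsoids. -/
lemma ellipsoid_inv_subset_polarSet_convexHull_iff {A : Matrix (Fin n) (Fin n) ℝ}
    (hA : A.PosDef) (K : Set (Euc n)) :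
    ellipsoid A⁻¹ ⊆ polarSet (convexHull ℝ K) ↔ K ⊆ ellipsoid A := by
  constructor
  · intro h x hx
    have h2 := polarSet_ellipsoid hA.inv
    rw [nonsing_inv_nonsing_inv _ hA.det_pos.ne'.isUnit] at h2
    rw [← h2]
    intro y hy
    rw [real_inner_comm]
    exact h hy x (subset_convexHull ℝ K hx)
  · intro h x hx
    rw [← polarSet_ellipsoid hA] at hx
    have hc : Convex ℝ {y : Euc n | inner ℝ x y ≤ 1} :=
      convex_halfSpace_le ((innerSL ℝ x).toLinearMap.isLinear) 1
    exact fun y hy => convexHull_min (fun y hy => hx y (h hy)) hc hy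

/-- If `ellipsoid A` is the unique minimal ellipsoid containing `K`, then it is `L_∞ K`. -/
lemma legendreInfty_eq {A : Matrix (Fin n) (Fin n) ℝ} (hA : A.PosDef) {K : Set (Euc n)}
    (hK : K ⊆ ellipsoid A)
    (hmax : ∀ B : Matrix (Fin n) (Fin n) ℝ, B.PosDef → K ⊆ ellipsoid B → B ≠ A → B.det < A.det) :
    legendreInfty K = ellipsoid A := by
  have hmx : IsUniqueVolumeMax {E | IsCenteredEllipsoid E ∧ E ⊆ polarSet (convexHull ℝ K)}
      (ellipsoid A⁻¹) := by
    refine ⟨⟨isCenteredEllipsoid_ellipsoid hA.inv,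
      (ellipsoid_inv_subset_polarSet_convexHull_iff hA K).2 hK⟩, ?_⟩
    rintro E ⟨hE, hEs⟩ hne
    obtain ⟨B, hB, rfl⟩ := hE.exists_eq_ellipsoid
    have hBi : B⁻¹⁻¹ = B := nonsing_inv_nonsing_inv _ hB.det_pos.ne'.isUnit
    have hBK : K ⊆ ellipsoid B⁻¹ :=
      (ellipsoid_inv_subset_polarSet_convexHull_iff hB.inv K).1 (by rwa [hBi])
    have hlt := hmax B⁻¹ hB.inv hBK fun h => hne (by rw [← h, hBi])
    apply volume_ellipsoid_lt hB hA.inv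
    rw [det_nonsing_inv, Ring.inverse_eq_inv'] at hlt ⊢
    exact inv_lt_of_inv_lt₀ hB.det_pos hlt
  have : johnInfty (polarSet (convexHull ℝ K)) = ellipsoid A⁻¹ :=
    (Classical.epsilon_spec (p := IsUniqueVolumeMax
      {E | IsCenteredEllipsoid E ∧ E ⊆ polarSet (convexHull ℝ K)}) ⟨_, hmx⟩).eq hmx
  rw [legendreInfty, this, polarSet_ellipsoid hA.inv,
    nonsing_inv_nonsing_inv _ hA.det_pos.ne'.isUnit]

/-- For a symmetric set the minimal centered ellipsoid is minimal among all ellipsoids. -/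
lemma IsUniqueVolumeMin.of_neg_eq {K L : Set (Euc n)} (hn : 1 ≤ n) (hK : -K = K)
    (hL : IsUniqueVolumeMin {E | IsCenteredEllipsoid E ∧ K ⊆ E} L) :
    IsUniqueVolumeMin {E | IsEllipsoid E ∧ K ⊆ E} L := by
  refine ⟨⟨?_, hL.1.2⟩, ?_⟩
  · obtain ⟨T, hT⟩ := hL.1.1
    exact ⟨0, T, by simpa using hT⟩
  rintro E ⟨⟨c, T, rfl⟩, hKE⟩ hne
  have hle : ∀ E, IsCenteredEllipsoid E → K ⊆ E → volume L ≤ volume E := by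
    intro E hE hKE
    by_cases h : E = L
    · rw [h]
    · exact (hL.2 E ⟨hE, hKE⟩ h).le
  by_cases hc : c = 0
  · subst hc
    simp only [zero_add] at hKE hne ⊢
    exact hL.2 _ ⟨⟨T, rfl⟩, hKE⟩ hne
  set d := T.symm c with hd
  have hd0 : 0 < ‖d‖ := norm_pos_iff.2 (by simpa [hd] using hc)
  have hx : ∀ x ∈ K, ‖T.symm x - d‖ ≤ 1 := by
    intro x hx
    obtain ⟨y, hy, rfl⟩ := hKE hx
    simpa [hd] using hy
  -- After applying `T⁻¹`, both `x` and `-x` lie within distance `1` of `d`; the parallelogram law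
  -- averages the two bounds, leaving a gain of `‖d‖ ^ 2` for the centered ellipsoid.
  have hx' : ∀ x ∈ K, ‖T.symm x‖ ^ 2 + ‖d‖ ^ 2 ≤ 1 := by
    intro x hxK
    have h1 := hx x hxK
    have h2 := hx (-x) (by rw [← hK]; simpa using hxK)
    rw [map_neg, ← neg_add', norm_neg] at h2
    have h3 := parallelogram_law_with_norm ℝ (T.symm x) d
    nlinarith [norm_nonneg (T.symm x + d), norm_nonneg (T.symm x - d)]
  -- The square root may be `0`; the maximum with `1 / 2` keeps the shrunken ellipsoid
  -- nondegenerate.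
  set r : ℝ := max (1 / 2) √(1 - ‖d‖ ^ 2) with hr
  have hr0 : 0 < r := lt_max_of_lt_left (by norm_num)
  have hr1 : r < 1 := max_lt (by norm_num) (by
    rw [Real.sqrt_lt' one_pos]; nlinarith)
  have hKr : K ⊆ r • (T '' Metric.closedBall 0 1) := by
    intro x hxK
    have hb : ‖T.symm x‖ ≤ r := le_max_of_le_right (Real.le_sqrt_of_sq_le (by
      linarith [hx' x hxK]))
    refine ⟨r⁻¹ • x, ⟨T.symm (r⁻¹ • x), ?_, by simp⟩, smul_inv_smul₀ hr0.ne' x⟩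
    rw [mem_closedBall_zero_iff, map_smul, norm_smul, norm_inv, Real.norm_of_nonneg hr0.le,
      inv_mul_le_iff₀ hr0, mul_one]
    exact hb
  have hcen : IsCenteredEllipsoid (r • (T '' Metric.closedBall 0 1)) := by
    refine ⟨(ContinuousLinearEquiv.smulLeft (Units.mk0 r hr0.ne')).trans T, ?_⟩
    ext x
    simp [Set.mem_smul_set]
  have hvol : volume ((fun x => c + T x) '' Metric.closedBall 0 1) =
      volume (T '' Metric.closedBall 0 1) := by
    have : (fun x => c + T x) '' Metric.closedBall 0 1 =
        (fun y => c + y) '' (T '' Metric.closedBall 0 1) := by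
      rw [Set.image_image]
    rw [this, Set.image_add_left, measure_preimage_add]
  rw [hvol]
  refine (hle _ hcen hKr).trans_lt ?_
  rw [Measure.addHaar_smul, finrank_euclideanSpace_fin, abs_of_pos (pow_pos hr0 n)]
  obtain ⟨B, hB, hTB⟩ := IsCenteredEllipsoid.exists_eq_ellipsoid
    (⟨T, rfl⟩ : IsCenteredEllipsoid (T '' Metric.closedBall (0 : Euc n) 1))
  have hpos : volume (T '' Metric.closedBall (0 : Euc n) 1) ≠ 0 := by
    rw [hTB, volume_ellipsoid hB]
    exact mul_ne_zero (by simpa using hB.det_pos) (Metric.measure_closedBall_pos _ _ one_pos).ne'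
  have hfin : volume (T '' Metric.closedBall (0 : Euc n) 1) ≠ ⊤ :=
    ((isCompact_closedBall 0 1).image T.continuous).measure_lt_top.ne
  conv_rhs => rw [← one_mul (volume _)]
  refine ENNReal.mul_lt_mul_left hpos hfin ?_
  rw [ENNReal.ofReal_lt_one]
  exact pow_lt_one₀ hr0.le hr1 (by omega)

end Ellipsoid

/-! ### The class `Φ` -/

namespace MemPhi

variable {φ : ℝ → ℝ}

lemma monotoneOn (hφ : MemPhi φ) : MonotoneOn φ (Set.Ici 0) := hφ.strictMonoOn.monotoneOn

lemma nonneg (hφ : MemPhi φ) {t : ℝ} (ht : 0 ≤ t) : 0 ≤ φ t := by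
  rw [← hφ.map_zero]; exact hφ.monotoneOn Set.self_mem_Ici ht ht

lemma pos (hφ : MemPhi φ) {t : ℝ} (ht : 0 < t) : 0 < φ t := by
  rw [← hφ.map_zero]; exact hφ.strictMonoOn Set.self_mem_Ici ht.le ht

lemma map_le_mul (hφ : MemPhi φ) {s t : ℝ} (hs : 0 ≤ s) (hs1 : s ≤ 1) (ht : 0 ≤ t) :
    φ (s * t) ≤ s * φ t := by
  have := hφ.convexOn.2 (x := 0) (y := t) Set.self_mem_Ici ht (sub_nonneg.2 hs1) hs
    (by ring)
  simpa [hφ.map_zero] using this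

/-- Convexity gives continuity only in the interior; at `0`, `φ` is squeezed between `0` and `t
φ(1)`. -/
lemma continuousOn (hφ : MemPhi φ) : ContinuousOn φ (Set.Ici 0) := by
  intro t ht
  rcases (show (0 : ℝ) ≤ t from ht).eq_or_lt with rfl | ht
  · have h : Tendsto (fun t => t * φ 1) (𝓝[Set.Ici 0] (0 : ℝ)) (𝓝 0) := by
      have : ContinuousAt (fun t : ℝ => t * φ 1) 0 := by fun_prop
      simpa using this.tendsto.mono_left nhdsWithin_le_nhds
    rw [ContinuousWithinAt, hφ.map_zero]
    refine tendsto_of_tendsto_of_tendsto_of_le_of_le' tendsto_const_nhds h ?_ ?_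
    · filter_upwards [self_mem_nhdsWithin] with t ht using hφ.nonneg ht
    · filter_upwards [self_mem_nhdsWithin, mem_nhdsWithin_of_mem_nhds (Iic_mem_nhds one_pos)]
        with t ht ht1
      simpa using hφ.map_le_mul ht ht1 zero_le_one
  · have h := hφ.convexOn.continuousOn_interior
    rw [interior_Ici] at h
    exact (h.continuousAt (Ioi_mem_nhds ht)).continuousWithinAt

lemma id : MemPhi fun t => t :=
  ⟨convexOn_id (convex_Ici 0), strictMonoOn_id, rfl⟩

lemma rpow (hφ : MemPhi φ) {p : ℝ} (hp : 1 ≤ p) : MemPhi fun t => φ t ^ p where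
  convexOn := by
    refine ⟨convex_Ici 0, fun x hx y hy a b ha hb hab => ?_⟩
    have hxy := hφ.convexOn.2 hx hy ha hb hab
    have h0 := hφ.nonneg ((convex_Ici (0 : ℝ)) hx hy ha hb hab)
    exact (Real.rpow_le_rpow h0 hxy (by linarith)).trans
      ((convexOn_rpow hp).2 (hφ.nonneg hx) (hφ.nonneg hy) ha hb hab)
  strictMonoOn := fun x hx y hy hxy =>
    Real.rpow_lt_rpow (hφ.nonneg hx) (hφ.strictMonoOn hx hy hxy) (by linarith)
  map_zero := by rw [hφ.map_zero, Real.zero_rpow (by linarith)]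

/-- For `t ≥ 1`, convexity and `φ(0) = 0` give `t φ(1) ≤ φ(t)`. Normalizing by `φ(1)` leaves
constants independent of `φ`, which makes the later bounds uniform in `p`. -/
lemma le_one_add (hφ : MemPhi φ) {t : ℝ} (ht : 0 ≤ t) : t ≤ 1 + (φ 1)⁻¹ * φ t := by
  have h1 := hφ.pos one_pos
  rcases le_total t 1 with h | h
  · have : 0 ≤ (φ 1)⁻¹ * φ t := mul_nonneg (inv_nonneg.2 h1.le) (hφ.nonneg ht)
    linarith
  · have h0 : 0 < t := by linarith
    have := hφ.map_le_mul (inv_nonneg.2 ht) (inv_le_one_of_one_le₀ h) ht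
    rw [inv_mul_cancel₀ h0.ne', ← div_eq_inv_mul, le_div_iff₀ h0] at this
    have : t ≤ (φ 1)⁻¹ * φ t := by
      rw [← div_eq_inv_mul, le_div_iff₀ h1]; linarith
    linarith

end MemPhi

/-! ### The determinant problem under energy constraints and its limit -/

section Energy

variable {n : ℕ} {μ : Measure (USphere n)} [IsFiniteMeasure μ] {x : USphere n → Euc n}
  {φ : ℝ → ℝ}

/-- The integral of `φ (|A x|)` over a field of vectors `x` on the sphere. -/
def energy (φ : ℝ → ℝ) (μ : Measure (USphere n)) (x : USphere n → Euc n)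
    (A : Matrix (Fin n) (Fin n) ℝ) : ℝ :=
  ∫ u, φ ‖act A (x u)‖ ∂μ

lemma continuous_norm_act (hx : Continuous x) :
    Continuous fun q : Matrix (Fin n) (Fin n) ℝ × USphere n => ‖act q.1 (x q.2)‖ :=
  ((continuous_act.comp continuous_fst).clm_apply (hx.comp continuous_snd)).norm

lemma continuous_norm_act_apply (hx : Continuous x) (A : Matrix (Fin n) (Fin n) ℝ) :
    Continuous fun u => ‖act A (x u)‖ :=
  ((act A).continuous.comp hx).norm

lemma continuous_norm_act_left (y : Euc n) :
    Continuous fun A : Matrix (Fin n) (Fin n) ℝ => ‖act A y‖ :=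
  (continuous_act.clm_apply continuous_const).norm

lemma MemPhi.continuous_integrand (hφ : MemPhi φ) (hx : Continuous x) :
    Continuous fun q : Matrix (Fin n) (Fin n) ℝ × USphere n => φ ‖act q.1 (x q.2)‖ :=
  hφ.continuousOn.comp_continuous (continuous_norm_act hx) fun _ => norm_nonneg _

lemma integrable_of_continuous {g : USphere n → ℝ} (hg : Continuous g) : Integrable g μ := by
  rw [← integrableOn_univ]
  exact hg.continuousOn.integrableOn_compact isCompact_univ

lemma integral_pos_of_continuous [μ.IsOpenPosMeasure] {g : USphere n → ℝ} (hg : Continuous g)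
    (h0 : ∀ u, 0 ≤ g u) {u : USphere n} (hu : g u ≠ 0) : 0 < ∫ u, g u ∂μ := by
  rw [integral_pos_iff_support_of_nonneg h0 (integrable_of_continuous hg)]
  exact hg.isOpen_support.measure_pos μ ⟨u, hu⟩

lemma MemPhi.integrable (hφ : MemPhi φ) (hx : Continuous x) (A : Matrix (Fin n) (Fin n) ℝ) :
    Integrable (fun u => φ ‖act A (x u)‖) μ :=
  integrable_of_continuous
    (hφ.continuousOn.comp_continuous (continuous_norm_act_apply hx A) fun _ => norm_nonneg _)

lemma MemPhi.continuous_energy (hφ : MemPhi φ) (hx : Continuous x) :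
    Continuous (energy φ μ x) := by
  have : FiniteDimensional ℝ (Matrix (Fin n) (Fin n) ℝ) := inferInstance
  have : ProperSpace (Matrix (Fin n) (Fin n) ℝ) := FiniteDimensional.proper ℝ _
  have h := continuous_parametric_integral_of_continuous (μ := μ)
    (f := fun A u => φ ‖act A (x u)‖) (hφ.continuous_integrand hx) isCompact_univ
  simp only [Measure.restrict_univ] at h
  exact h

/-- The norm is convex in `A`, and composition with the increasing convex `φ` preserves this. -/
lemma MemPhi.convexOn_energy (hφ : MemPhi φ) (hx : Continuous x) :
    ConvexOn ℝ Set.univ (energy φ μ x) := by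
  refine ⟨convex_univ, fun A _ B _ a b ha hb hab => ?_⟩
  simp only [energy, smul_eq_mul]
  rw [← integral_const_mul, ← integral_const_mul, ← integral_add
    ((hφ.integrable hx A).const_mul a) ((hφ.integrable hx B).const_mul b)]
  refine integral_mono (hφ.integrable hx _) (((hφ.integrable hx A).const_mul a).add
    ((hφ.integrable hx B).const_mul b)) fun u => ?_
  have h1 : ‖act (a • A + b • B) (x u)‖ ≤ a * ‖act A (x u)‖ + b * ‖act B (x u)‖ := by
    rw [act_add, act_smul, act_smul]
    refine (norm_add_le _ _).trans (le_of_eq ?_)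
    simp [norm_smul, abs_of_nonneg ha, abs_of_nonneg hb]
  have h2 : 0 ≤ a * ‖act A (x u)‖ + b * ‖act B (x u)‖ := by positivity
  exact (hφ.monotoneOn (norm_nonneg _) h2 h1).trans
    (hφ.convexOn.2 (norm_nonneg _) (norm_nonneg _) ha hb hab)

lemma MemPhi.energy_le_of_norm_le_one (hφ : MemPhi φ) (hx : Continuous x)
    {A : Matrix (Fin n) (Fin n) ℝ} (hA : ∀ u, ‖act A (x u)‖ ≤ 1) :
    energy φ μ x A ≤ μ.real Set.univ * φ 1 := by
  calc energy φ μ x A ≤ ∫ _, φ 1 ∂μ :=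
        integral_mono (hφ.integrable hx A) (integrable_const _) fun u =>
          hφ.monotoneOn (norm_nonneg _) (Set.mem_Ici.2 zero_le_one) (hA u)
    _ = μ.real Set.univ * φ 1 := by simp

/-- The vectors of the field `x` span: only the zero matrix annihilates all of them. -/
def Spanning (x : USphere n → Euc n) : Prop :=
  ∀ A : Matrix (Fin n) (Fin n) ℝ, (∀ u, act A (x u) = 0) → A = 0

/-- Matrices of bounded energy are bounded, uniformly in `φ`. -/
lemma exists_norm_le [μ.IsOpenPosMeasure] (hx : Continuous x) (hs : Spanning x) :
    ∃ R : ℝ, ∀ φ, MemPhi φ → ∀ A : Matrix (Fin n) (Fin n) ℝ,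
      energy φ μ x A ≤ μ.real Set.univ * φ 1 → ‖A‖ ≤ R := by
  have : ProperSpace (Matrix (Fin n) (Fin n) ℝ) := FiniteDimensional.proper ℝ _
  -- The energy for `φ(t) = t` is continuous and positive on the unit sphere of matrices, hence
  -- bounded below there by some `c > 0`; homogeneity then makes it at least `c ‖A‖` everywhere.
  obtain ⟨c, hc, hcA⟩ := (isCompact_sphere (0 : Matrix (Fin n) (Fin n) ℝ) 1).exists_forall_le'
    (f := energy (fun t => t) μ x) (MemPhi.id.continuous_energy hx).continuousOn (a := 0) (by
      intro A hA
      have hA0 : A ≠ 0 := by rintro rfl; simp at hA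
      obtain ⟨u, hu⟩ : ∃ u, act A (x u) ≠ 0 := by
        by_contra! h; exact hA0 (hs A h)
      exact integral_pos_of_continuous (continuous_norm_act_apply hx A) (fun _ => norm_nonneg _) (norm_ne_zero_iff.2 hu))
  have hhom : ∀ A : Matrix (Fin n) (Fin n) ℝ, c * ‖A‖ ≤ energy (fun t => t) μ x A := by
    intro A
    by_cases hA : A = 0
    · simp only [hA, norm_zero, mul_zero]
      exact integral_nonneg fun _ => norm_nonneg _
    have hp : 0 < ‖A‖ := norm_pos_iff.2 hA
    have h := hcA (‖A‖⁻¹ • A) (by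
      rw [mem_sphere_zero_iff_norm, norm_smul, norm_inv, norm_norm, inv_mul_cancel₀ hp.ne'])
    have h2 : energy (fun t => t) μ x (‖A‖⁻¹ • A) = ‖A‖⁻¹ * energy (fun t => t) μ x A := by
      simp only [energy, act_smul]
      rw [← integral_const_mul]
      congr 1 with u
      simp [norm_smul]
    rwa [h2, ← div_eq_inv_mul, le_div_iff₀ hp] at h
  refine ⟨2 * μ.real Set.univ / c, fun φ hφ A hA => ?_⟩
  rw [le_div_iff₀ hc, mul_comm]
  refine (hhom A).trans ?_
  have h1 := hφ.pos one_pos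
  calc energy (fun t => t) μ x A ≤ ∫ u, (1 + (φ 1)⁻¹ * φ ‖act A (x u)‖) ∂μ :=
        integral_mono (MemPhi.id.integrable hx A)
          ((integrable_const _).add ((hφ.integrable hx A).const_mul _))
          fun u => hφ.le_one_add (norm_nonneg _)
    _ = μ.real Set.univ + (φ 1)⁻¹ * energy φ μ x A := by
        rw [integral_add (integrable_const _) ((hφ.integrable hx A).const_mul _),
          integral_const_mul]
        simp [energy]
    _ ≤ μ.real Set.univ + (φ 1)⁻¹ * (μ.real Set.univ * φ 1) := by gcongr
    _ = 2 * μ.real Set.univ := by field_simp; ring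

/-- The positive semidefinite matrices satisfying the Orlicz constraint. -/
def feasible (φ : ℝ → ℝ) (μ : Measure (USphere n)) (x : USphere n → Euc n) :
    Set (Matrix (Fin n) (Fin n) ℝ) :=
  {A | A.PosSemidef ∧ energy φ μ x A ≤ μ.real Set.univ * φ 1}

/-- The positive semidefinite matrices mapping the field `x` into the unit ball. -/
def feasibleInfty (x : USphere n → Euc n) : Set (Matrix (Fin n) (Fin n) ℝ) :=
  {A | A.PosSemidef ∧ ∀ u, ‖act A (x u)‖ ≤ 1}

lemma MemPhi.feasibleInfty_subset (hφ : MemPhi φ) (hx : Continuous x) :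
    feasibleInfty x ⊆ feasible φ μ x :=
  fun _ hA => ⟨hA.1, hφ.energy_le_of_norm_le_one hx hA.2⟩

lemma convex_setOf_posSemidef : Convex ℝ {A : Matrix (Fin n) (Fin n) ℝ | A.PosSemidef} :=
  fun _ hA _ hB _ _ ha hb _ => (hA.smul ha).add (hB.smul hb)

/-- A small multiple of the identity works, since the field is bounded. -/
lemma exists_posDef_mem_feasibleInfty (hx : Continuous x) :
    ∃ A ∈ feasibleInfty x, A.PosDef := by
  obtain ⟨M, hM⟩ := (isCompact_range hx).isBounded.exists_norm_le
  have hM0 : 0 < (|M| + 1)⁻¹ := by positivity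
  have hp : ((|M| + 1)⁻¹ • (1 : Matrix (Fin n) (Fin n) ℝ)).PosDef := PosDef.one.smul hM0
  refine ⟨_, ⟨hp.posSemidef, fun u => ?_⟩, hp⟩
  rw [act_smul, act_one]
  have h1 := (hM _ ⟨u, rfl⟩).trans (le_abs_self M)
  change ‖(|M| + 1)⁻¹ • x u‖ ≤ 1
  rw [norm_smul, Real.norm_of_nonneg hM0.le, inv_mul_le_iff₀ (by positivity)]
  linarith

lemma MemPhi.exists_feasible_max [μ.IsOpenPosMeasure] (hφ : MemPhi φ) (hx : Continuous x)
    (hs : Spanning x) :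
    ∃ A ∈ feasible φ μ x, A.PosDef ∧ ∀ B ∈ feasible φ μ x, B ≠ A → B.det < A.det := by
  have : ProperSpace (Matrix (Fin n) (Fin n) ℝ) := FiniteDimensional.proper ℝ _
  obtain ⟨R, hR⟩ := exists_norm_le (μ := μ) hx hs
  refine exists_det_lt_of_isCompact (Metric.isCompact_of_isClosed_isBounded ?_ ?_) ?_
    (fun A hA => hA.1) ?_
  · exact isClosed_setOf_posSemidef.inter
      (isClosed_le (hφ.continuous_energy hx) continuous_const)
  · exact isBounded_iff_forall_norm_le.2 ⟨R, fun A hA => hR φ hφ A hA.2⟩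
  · have h := (hφ.convexOn_energy (μ := μ) hx).convex_le (μ.real Set.univ * φ 1)
    simp only [Set.mem_univ, true_and] at h
    exact convex_setOf_posSemidef.inter h
  · obtain ⟨A, hA, hAp⟩ := exists_posDef_mem_feasibleInfty hx
    exact ⟨A, hφ.feasibleInfty_subset hx hA, hAp⟩

/-- Boundedness is inherited from the energy constraint for `φ(t) = t`; the measure serves only this
purpose. -/
lemma exists_feasibleInfty_max [μ.IsOpenPosMeasure] (hx : Continuous x) (hs : Spanning x) :
    ∃ A ∈ feasibleInfty x, A.PosDef ∧ ∀ B ∈ feasibleInfty x, B ≠ A → B.det < A.det := by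
  have : ProperSpace (Matrix (Fin n) (Fin n) ℝ) := FiniteDimensional.proper ℝ _
  obtain ⟨R, hR⟩ := exists_norm_le (μ := μ) hx hs
  refine exists_det_lt_of_isCompact (Metric.isCompact_of_isClosed_isBounded ?_ ?_) ?_
    (fun A hA => hA.1) (exists_posDef_mem_feasibleInfty hx)
  · refine isClosed_setOf_posSemidef.inter (s₂ := {A | ∀ u, ‖act A (x u)‖ ≤ 1}) ?_
    rw [Set.ofPred_forall]
    exact isClosed_iInter fun u => isClosed_le
      (continuous_norm_act_left (x u)) continuous_const
  · exact isBounded_iff_forall_norm_le.2 ⟨R, fun A hA =>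
      hR _ MemPhi.id A (MemPhi.id.feasibleInfty_subset hx hA).2⟩
  · intro A hA B hB a b ha hb hab
    refine ⟨convex_setOf_posSemidef hA.1 hB.1 ha hb hab, fun u => ?_⟩
    rw [act_add, act_smul, act_smul]
    refine (norm_add_le _ _).trans ?_
    change ‖a • act A (x u)‖ + ‖b • act B (x u)‖ ≤ 1
    rw [norm_smul, norm_smul, Real.norm_of_nonneg ha, Real.norm_of_nonneg hb]
    nlinarith [hA.2 u, hB.2 u]

/-- A cluster point of matrices satisfying the constraints for `φ ^ p`, `p → ∞`, maps the field
into the unit ball. -/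
lemma MemPhi.norm_act_le_one_of_mapClusterPt [μ.IsOpenPosMeasure] (hφ : MemPhi φ)
    (hx : Continuous x) {f : ℝ → Matrix (Fin n) (Fin n) ℝ}
    (hf : ∀ᶠ p in atTop, energy (fun t => φ t ^ p) μ x (f p) ≤ μ.real Set.univ * φ 1 ^ p)
    {A : Matrix (Fin n) (Fin n) ℝ} (hA : MapClusterPt A atTop f) (u : USphere n) :
    ‖act A (x u)‖ ≤ 1 := by
  by_contra! h
  -- With `1 < s < |A x(u)|`, continuity gives neighborhoods `U` of `A` and `V` of `u` on which the
  -- norm still exceeds `s`. A matrix in `U` then has energy at least `μ(V) φ(s) ^ p`, against the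
  -- allowed `|μ| φ(1) ^ p`.
  obtain ⟨s, hs1, hs⟩ := exists_between h
  have hs0 : 0 < s := by linarith
  have hopen : IsOpen {q : Matrix (Fin n) (Fin n) ℝ × USphere n | s < ‖act q.1 (x q.2)‖} :=
    isOpen_lt continuous_const (continuous_norm_act hx)
  obtain ⟨U, V, hU, hV, hAU, huV, hUV⟩ := isOpen_prod_iff.1 hopen A u hs
  have hVpos : 0 < μ.real V :=
    ENNReal.toReal_pos (hV.measure_pos μ ⟨u, huV⟩).ne' (measure_ne_top μ V)
  have h1 := hφ.pos one_pos
  have hq : 1 < φ s / φ 1 := by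
    rw [one_lt_div h1]
    exact hφ.strictMonoOn (Set.mem_Ici.2 zero_le_one) hs0.le hs1
  have hlim : ∀ᶠ p : ℝ in atTop, μ.real Set.univ / μ.real V < (φ s / φ 1) ^ p :=
    (tendsto_rpow_atTop_of_base_gt_one _ hq).eventually_gt_atTop _
  obtain ⟨p, hpU, hpl, hpe, hp1⟩ := ((hA.frequently (hU.mem_nhds hAU)).and_eventually
    (hlim.and (hf.and (eventually_ge_atTop 1)))).exists
  have hφp := hφ.rpow hp1
  have hle : μ.real V * φ s ^ p ≤ energy (fun t => φ t ^ p) μ x (f p) := by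
    calc μ.real V * φ s ^ p = ∫ _ in V, φ s ^ p ∂μ := by simp
      _ ≤ ∫ v in V, φ ‖act (f p) (x v)‖ ^ p ∂μ := by
          refine setIntegral_mono_on (integrable_const _).integrableOn
            (hφp.integrable hx (f p)).integrableOn hV.measurableSet fun v hv => ?_
          exact hφp.monotoneOn hs0.le (norm_nonneg _) (hUV (Set.mk_mem_prod hpU hv)).le
      _ ≤ energy (fun t => φ t ^ p) μ x (f p) :=
          setIntegral_le_integral (hφp.integrable hx (f p))
            (Eventually.of_forall fun v => hφp.nonneg (norm_nonneg _))
  rw [Real.div_rpow (hφ.nonneg hs0.le) h1.le, div_lt_div_iff₀ hVpos (Real.rpow_pos_of_pos h1 p)]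
    at hpl
  linarith

/-- In a compact set, a family with only one possible cluster point converges. Here `A` competes in
every problem, so each cluster point has determinant at least `det A`, while being feasible for the
limit problem. -/
lemma MemPhi.tendsto_feasible_max [μ.IsOpenPosMeasure] (hφ : MemPhi φ)
    (hx : Continuous x) (hs : Spanning x) {f : ℝ → Matrix (Fin n) (Fin n) ℝ}
    (hf : ∀ p, 1 ≤ p → f p ∈ feasible (fun t => φ t ^ p) μ x)
    (hfmax : ∀ p, 1 ≤ p → ∀ B ∈ feasible (fun t => φ t ^ p) μ x, B ≠ f p → B.det < (f p).det)
    {A : Matrix (Fin n) (Fin n) ℝ} (hA : A ∈ feasibleInfty x)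
    (hAmax : ∀ B ∈ feasibleInfty x, B ≠ A → B.det < A.det) :
    Tendsto f atTop (𝓝 A) := by
  have : ProperSpace (Matrix (Fin n) (Fin n) ℝ) := FiniteDimensional.proper ℝ _
  obtain ⟨R, hR⟩ := exists_norm_le (μ := μ) hx hs
  have hc : IsCompact ({B : Matrix (Fin n) (Fin n) ℝ | B.PosSemidef} ∩ {B | A.det ≤ B.det} ∩
      Metric.closedBall 0 R) :=
    (isCompact_closedBall 0 R).inter_left (isClosed_setOf_posSemidef.inter
      (isClosed_le continuous_const (Continuous.matrix_det continuous_id)))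
  refine hc.tendsto_nhds_of_unique_mapClusterPt ?_ fun B hB hcl => ?_
  · filter_upwards [eventually_ge_atTop 1] with p hp
    refine ⟨⟨(hf p hp).1, ?_⟩, ?_⟩
    · by_cases h : A = f p
      · exact (congrArg det h).le
      · exact (hfmax p hp A ((hφ.rpow hp).feasibleInfty_subset hx hA) h).le
    · rw [mem_closedBall_zero_iff]
      exact hR _ (hφ.rpow hp) _ (hf p hp).2
  · by_contra hne
    refine (hAmax B ⟨hB.1.1, hφ.norm_act_le_one_of_mapClusterPt hx (μ := μ) ?_ hcl⟩ hne).not_ge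
      hB.1.2
    filter_upwards [eventually_ge_atTop 1] with p hp using (hf p hp).2

end Energy

/-! ### From matrix convergence to convergence of ellipsoids -/

section Convergence

variable {n : ℕ}

/-- Both ellipsoids are images of one unit ball, so `A⁻¹ y` is paired with `B⁻¹ y`. -/
lemma hausdorffDist_ellipsoid_le {A B : Matrix (Fin n) (Fin n) ℝ} (hA : A.PosDef)
    (hB : B.PosDef) : Metric.hausdorffDist (ellipsoid A) (ellipsoid B) ≤ ‖A⁻¹ - B⁻¹‖ := by
  have key : ∀ {A B : Matrix (Fin n) (Fin n) ℝ}, ∀ y ∈ Metric.closedBall (0 : Euc n) 1,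
      dist (act A y) (act B y) ≤ ‖A - B‖ := by
    intro A B y hy
    rw [dist_eq_norm]
    have : act A y - act B y = act (A - B) y := by rw [act_sub]; rfl
    rw [this]
    exact (norm_act_apply_le _ _).trans
      (mul_le_of_le_one_right (norm_nonneg _) (by simpa using hy))
  rw [ellipsoid_eq_image hA, ellipsoid_eq_image hB]
  refine Metric.hausdorffDist_le_of_mem_dist (norm_nonneg _) ?_ ?_
  · rintro _ ⟨y, hy, rfl⟩
    exact ⟨_, ⟨y, hy, rfl⟩, key y hy⟩
  · rintro _ ⟨y, hy, rfl⟩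
    refine ⟨_, ⟨y, hy, rfl⟩, ?_⟩
    rw [norm_sub_rev]
    exact key y hy

lemma inv_norm_act_le {A : Matrix (Fin n) (Fin n) ℝ} (hA : A.PosDef) (u : USphere n) :
    ‖act A u‖⁻¹ ≤ ‖A⁻¹‖ := by
  have h := norm_act_apply_le A⁻¹ (act A u)
  rw [act_inv_act hA, norm_eq_of_mem_sphere] at h
  rwa [← one_div, div_le_iff₀ (norm_act_apply_pos hA (ne_zero_of_mem_unit_sphere u))]

/-- The radial functions are `1 / |A u|` and `1 / |B u|`; the difference of reciprocals is
controlled by `1 / |A u| ≤ ‖A⁻¹‖` and its analogue for `B`. -/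
lemma dualHausdorffDist_ellipsoid_le {A B : Matrix (Fin n) (Fin n) ℝ} (hA : A.PosDef)
    (hB : B.PosDef) :
    dualHausdorffDist (ellipsoid A) (ellipsoid B) ≤ ‖A - B‖ * (‖A⁻¹‖ * ‖B⁻¹‖) := by
  refine Real.iSup_le (fun u => ?_) (by positivity)
  have hu := ne_zero_of_mem_unit_sphere u
  have ha := norm_act_apply_pos hA hu
  have hb := norm_act_apply_pos hB hu
  rw [radial_ellipsoid hA hu, radial_ellipsoid hB hu]
  have h1 : ‖act A u‖⁻¹ - ‖act B u‖⁻¹ =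
      (‖act B u‖ - ‖act A u‖) * (‖act A u‖⁻¹ * ‖act B u‖⁻¹) := by
    field_simp
  have h2 : |‖act B u‖ - ‖act A u‖| ≤ ‖A - B‖ := by
    refine (abs_norm_sub_norm_le _ _).trans ?_
    rw [norm_sub_rev]
    have : act A (u : Euc n) - act B u = act (A - B) u := by rw [act_sub]; rfl
    rw [this]
    simpa using norm_act_apply_le (A - B) u
  rw [h1, abs_mul, abs_of_pos (mul_pos (inv_pos.2 ha) (inv_pos.2 hb))]
  exact mul_le_mul h2 (mul_le_mul (inv_norm_act_le hA u) (inv_norm_act_le hB u)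
    (inv_nonneg.2 hb.le) (norm_nonneg _)) (by positivity) (norm_nonneg _)

lemma continuousAt_matrix_inv {A : Matrix (Fin n) (Fin n) ℝ} (hA : A.PosDef) :
    ContinuousAt (fun B : Matrix (Fin n) (Fin n) ℝ => B⁻¹) A := by
  have h : (fun B : Matrix (Fin n) (Fin n) ℝ => B⁻¹) = fun B => B.det⁻¹ • B.adjugate := by
    ext1 B; rw [inv_def, Ring.inverse_eq_inv']
  rw [h]
  exact ((Continuous.matrix_det continuous_id).continuousAt.inv₀ hA.det_pos.ne').smul
    (Continuous.matrix_adjugate continuous_id).continuousAt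

variable {f : ℝ → Matrix (Fin n) (Fin n) ℝ} {A : Matrix (Fin n) (Fin n) ℝ}

lemma tendsto_hausdorffDist_ellipsoid (hA : A.PosDef) (hf : ∀ᶠ p in atTop, (f p).PosDef)
    (h : Tendsto f atTop (𝓝 A)) :
    Tendsto (fun p => Metric.hausdorffDist (ellipsoid (f p)) (ellipsoid A)) atTop (𝓝 0) := by
  have hi := (continuousAt_matrix_inv hA).tendsto.comp h
  refine tendsto_of_tendsto_of_tendsto_of_le_of_le' tendsto_const_nhds
    (tendsto_iff_norm_sub_tendsto_zero.1 hi)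
    (Eventually.of_forall fun _ => Metric.hausdorffDist_nonneg) ?_
  filter_upwards [hf] with p hp using hausdorffDist_ellipsoid_le hp hA

lemma tendsto_dualHausdorffDist_ellipsoid (hA : A.PosDef) (hf : ∀ᶠ p in atTop, (f p).PosDef)
    (h : Tendsto f atTop (𝓝 A)) :
    Tendsto (fun p => dualHausdorffDist (ellipsoid (f p)) (ellipsoid A)) atTop (𝓝 0) := by
  have hi := (continuousAt_matrix_inv hA).tendsto.comp h
  have hlim := (tendsto_iff_norm_sub_tendsto_zero.1 h).mul (hi.norm.mul_const ‖A⁻¹‖)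
  rw [zero_mul] at hlim
  refine tendsto_of_tendsto_of_tendsto_of_le_of_le' tendsto_const_nhds hlim
    (Eventually.of_forall fun _ => Real.iSup_nonneg fun _ => abs_nonneg _) ?_
  filter_upwards [hf] with p hp using dualHausdorffDist_ellipsoid_le hp hA

end Convergence

/-! ### Star bodies and the translation of the constraints -/

section StarBody

variable {n : ℕ} {K : Set (Euc n)}

lemma IsStarBody.bddAbove (hK : IsStarBody K) {x : Euc n} (hx : x ≠ 0) :
    BddAbove {t : ℝ | 0 ≤ t ∧ t • x ∈ K} := by
  obtain ⟨R, hR⟩ := hK.isCompact.isBounded.exists_norm_le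
  refine ⟨R / ‖x‖, fun t ht => ?_⟩
  have := hR _ ht.2
  rwa [norm_smul, Real.norm_of_nonneg ht.1, ← le_div_iff₀ (norm_pos_iff.2 hx)] at this

lemma IsStarBody.le_radial (hK : IsStarBody K) {x : Euc n} (hx : x ≠ 0) {t : ℝ} (ht : 0 ≤ t)
    (htx : t • x ∈ K) : t ≤ radial K x :=
  le_csSup (hK.bddAbove hx) ⟨ht, htx⟩

lemma IsStarBody.radial_smul_mem (hK : IsStarBody K) {x : Euc n} (hx : x ≠ 0) :
    radial K x • x ∈ K := by
  have hc : IsClosed {t : ℝ | 0 ≤ t ∧ t • x ∈ K} :=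
    isClosed_Ici.inter (hK.isCompact.isClosed.preimage (continuous_id.smul continuous_const))
  exact (hc.csSup_mem ⟨0, le_rfl, by simpa using interior_subset hK.zero_mem_interior⟩
    (hK.bddAbove hx)).2

lemma IsStarBody.radial_pos (hK : IsStarBody K) {x : Euc n} (hx : x ≠ 0) : 0 < radial K x := by
  obtain ⟨r, hr, hrK⟩ := Metric.mem_nhds_iff.1 (mem_interior_iff_mem_nhds.1 hK.zero_mem_interior)
  have hp : 0 < r / 2 / ‖x‖ := div_pos (half_pos hr) (norm_pos_iff.2 hx)
  refine hp.trans_le (hK.le_radial hx hp.le (hrK ?_))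
  rw [mem_ball_zero_iff, norm_smul, Real.norm_of_nonneg hp.le,
    div_mul_cancel₀ _ (norm_ne_zero_iff.2 hx)]
  linarith

/-- The boundary point `ρ_K(u) u` of `K` in the direction `u`. -/
def boundaryPoint (K : Set (Euc n)) (u : USphere n) : Euc n := radial K u • (u : Euc n)

lemma IsStarBody.continuous_radial (hK : IsStarBody K) :
    Continuous fun u : USphere n => radial K u :=
  continuousOn_iff_continuous_domRestrict.1 hK.continuousOn_radial

lemma IsStarBody.continuous_boundaryPoint (hK : IsStarBody K) : Continuous (boundaryPoint K) :=
  hK.continuous_radial.smul continuous_subtype_val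

lemma norm_act_boundaryPoint (hK : IsStarBody K) (A : Matrix (Fin n) (Fin n) ℝ)
    (u : USphere n) : ‖act A (boundaryPoint K u)‖ = radial K u * ‖act A u‖ := by
  rw [boundaryPoint, map_smul, norm_smul,
    Real.norm_of_nonneg (hK.radial_pos (ne_zero_of_mem_unit_sphere u)).le]

/-- The radial function is positive, so every direction occurs among the boundary points. -/
lemma IsStarBody.spanning (hK : IsStarBody K) : Spanning (boundaryPoint K) := by
  intro A hA
  rw [← norm_eq_zero, ← norm_act, norm_eq_zero]
  ext1 x
  by_cases hx : x = 0
  · simp [hx]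
  have hp : 0 < ‖x‖ := norm_pos_iff.2 hx
  set u : USphere n := ⟨‖x‖⁻¹ • x, by
    rw [mem_sphere_zero_iff_norm, norm_smul, norm_inv, norm_norm, inv_mul_cancel₀ hp.ne']⟩
  have h := hA u
  rw [boundaryPoint, map_smul,
    smul_eq_zero_iff_right (hK.radial_pos (ne_zero_of_mem_unit_sphere u)).ne'] at h
  rw [show x = ‖x‖ • (u : Euc n) from (smul_inv_smul₀ hp.ne' x).symm, map_smul, h, smul_zero]
  rfl

lemma IsStarBody.subset_ellipsoid_iff (hK : IsStarBody K) (A : Matrix (Fin n) (Fin n) ℝ) :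
    K ⊆ ellipsoid A ↔ ∀ u, ‖act A (boundaryPoint K u)‖ ≤ 1 := by
  constructor
  · exact fun h u => h (hK.radial_smul_mem (ne_zero_of_mem_unit_sphere u))
  · intro h x hxK
    by_cases hx : x = 0
    · simp [hx, ellipsoid]
    have hp : 0 < ‖x‖ := norm_pos_iff.2 hx
    set u : USphere n := ⟨‖x‖⁻¹ • x, by
      rw [mem_sphere_zero_iff_norm, norm_smul, norm_inv, norm_norm, inv_mul_cancel₀ hp.ne']⟩
    have hxu : x = ‖x‖ • (u : Euc n) := (smul_inv_smul₀ hp.ne' x).symm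
    have hle : ‖x‖ ≤ radial K u :=
      hK.le_radial (ne_zero_of_mem_unit_sphere u) hp.le (by rwa [← hxu])
    have h1 := h u
    rw [norm_act_boundaryPoint hK] at h1
    change ‖act A x‖ ≤ 1
    rw [hxu, map_smul, norm_smul, norm_norm]
    exact (mul_le_mul_of_nonneg_right hle (norm_nonneg _)).trans h1

lemma IsStarBody.continuous_density (hK : IsStarBody K) :
    Continuous fun u : USphere n => radial K u ^ n / n :=
  (hK.continuous_radial.pow n).div_const _

lemma IsStarBody.isFiniteMeasure (hK : IsStarBody K) : IsFiniteMeasure (dualConicalMeasure K) :=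
  isFiniteMeasure_withDensity_ofReal (integrable_of_continuous hK.continuous_density).2

/-- The density is strictly positive, so spherical measure is absolutely continuous with respect to
`dualConicalMeasure K`. For `n = 0` the density would be `0`, as division by zero gives `0`. -/
lemma IsStarBody.isOpenPosMeasure (hK : IsStarBody K) (hn : 1 ≤ n) :
    (dualConicalMeasure K).IsOpenPosMeasure := by
  have : NeZero n := ⟨by omega⟩
  refine (withDensity_absolutelyContinuous' (μ := (volume : Measure (Euc n)).toSphere)
    hK.continuous_density.measurable.ennreal_ofReal.aemeasurable
    (Eventually.of_forall fun u => ?_)).isOpenPosMeasure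
  have h1 := hK.radial_pos (ne_zero_of_mem_unit_sphere u)
  have h2 : (0 : ℝ) < n := by exact_mod_cast hn
  exact (ENNReal.ofReal_pos.2 (div_pos (pow_pos h1 n) h2)).ne'

lemma measureReal_univ_pos {μ : Measure (USphere n)} [IsFiniteMeasure μ] [μ.IsOpenPosMeasure]
    (hn : 1 ≤ n) : 0 < μ.real Set.univ := by
  have : NeZero n := ⟨by omega⟩
  have : Nonempty (USphere n) := (NormedSpace.sphere_nonempty.2 zero_le_one).to_subtype
  exact ENNReal.toReal_pos (isOpen_univ.measure_pos μ Set.univ_nonempty).ne'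
    (measure_ne_top _ _)

/-- The constraint `O_φ(K, E) ≤ 1` in terms of the energy. -/
lemma MemPhi.orliczO_ellipsoid_le_one_iff {φ : ℝ → ℝ} (hφ : MemPhi φ) (hK : IsStarBody K)
    (hn : 1 ≤ n) {A : Matrix (Fin n) (Fin n) ℝ} (hA : A.PosDef) :
    orliczO φ K (ellipsoid A) ≤ 1 ↔
      energy φ (dualConicalMeasure K) (boundaryPoint K) A ≤
        (dualConicalMeasure K).real Set.univ * φ 1 := by
  have := hK.isFiniteMeasure
  have := hK.isOpenPosMeasure hn
  have hx := hK.continuous_boundaryPoint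
  set μ := dualConicalMeasure K with hμ
  have hm : 0 < μ.real Set.univ := measureReal_univ_pos hn
  -- Dividing the quotient of radial functions by `t` amounts to replacing `A` by `t⁻¹ A`.
  have hset : {t : ℝ | 0 < t ∧ (μ.real Set.univ)⁻¹ *
      ∫ u : USphere n, φ (radial K u / radial (ellipsoid A) u / t) ∂μ ≤ φ 1} =
      {t : ℝ | 0 < t ∧ energy φ μ (boundaryPoint K) (t⁻¹ • A) ≤ μ.real Set.univ * φ 1} := by
    ext t
    refine and_congr_right fun ht => ?_
    rw [inv_mul_le_iff₀ hm]
    have : ∀ u : USphere n, radial K u / radial (ellipsoid A) u / t =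
        ‖act (t⁻¹ • A) (boundaryPoint K u)‖ := by
      intro u
      rw [radial_ellipsoid hA (ne_zero_of_mem_unit_sphere u), div_inv_eq_mul, act_smul]
      change _ = ‖t⁻¹ • act A (boundaryPoint K u)‖
      rw [norm_smul, norm_act_boundaryPoint hK, Real.norm_of_nonneg (inv_nonneg.2 ht.le)]
      ring
    simp only [this, energy]
  rw [orliczO, orliczNorm, hset]
  have hbdd : BddBelow {t : ℝ | 0 < t ∧
      energy φ μ (boundaryPoint K) (t⁻¹ • A) ≤ μ.real Set.univ * φ 1} := ⟨0, fun t ht => ht.1.le⟩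
  constructor
  · intro h
    -- Without this, the bound on the infimum would say nothing: `sInf ∅ = 0`.
    have hne : {t : ℝ | 0 < t ∧
        energy φ μ (boundaryPoint K) (t⁻¹ • A) ≤ μ.real Set.univ * φ 1}.Nonempty := by
      obtain ⟨M, hM⟩ := (isCompact_range (continuous_norm_act_apply hx A)).bddAbove
      have hpos : 0 < |M| + 1 := by positivity
      refine ⟨|M| + 1, hpos, hφ.energy_le_of_norm_le_one hx fun u => ?_⟩
      rw [act_smul]
      change ‖(|M| + 1)⁻¹ • act A (boundaryPoint K u)‖ ≤ 1
      rw [norm_smul, Real.norm_of_nonneg (inv_nonneg.2 hpos.le), inv_mul_le_iff₀ hpos]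
      linarith [hM ⟨u, rfl⟩, le_abs_self M]
    -- Attainment of the infimum is not needed: every `s > 1` lies above an admissible `t` and is
    -- admissible by monotonicity, and `s` then decreases to `1`.
    have hcont : Tendsto (fun t : ℝ => energy φ μ (boundaryPoint K) (t⁻¹ • A)) (𝓝[>] 1)
        (𝓝 (energy φ μ (boundaryPoint K) A)) := by
      have h1 : Tendsto (fun t : ℝ => t⁻¹ • A) (𝓝 1) (𝓝 A) := by
        have : ContinuousAt (fun t : ℝ => t⁻¹ • A) 1 :=
          (continuousAt_inv₀ one_ne_zero).smul continuousAt_const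
        simpa using this.tendsto
      exact ((hφ.continuous_energy hx).tendsto A).comp (h1.mono_left nhdsWithin_le_nhds)
    refine le_of_tendsto hcont ?_
    filter_upwards [self_mem_nhdsWithin] with s hs
    obtain ⟨t, ⟨ht0, ht⟩, hts⟩ := exists_lt_of_csInf_lt hne (h.trans_lt hs)
    refine le_trans ?_ ht
    refine integral_mono (hφ.integrable hx _) (hφ.integrable hx _) fun u => ?_
    refine hφ.monotoneOn (norm_nonneg _) (norm_nonneg _) ?_
    rw [act_smul, act_smul]
    change ‖s⁻¹ • act A (boundaryPoint K u)‖ ≤ ‖t⁻¹ • act A (boundaryPoint K u)‖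
    have hs0 : 0 < s := ht0.trans hts
    rw [norm_smul, norm_smul, Real.norm_of_nonneg (inv_nonneg.2 hs0.le),
      Real.norm_of_nonneg (inv_nonneg.2 ht0.le)]
    gcongr
  · intro h
    exact csInf_le hbdd ⟨one_pos, by simpa using h⟩

end StarBody

end OrliczLegendre

end

/-! ### The main theorem -/

open OrliczLegendre in
theorem theorem6p4 (n : ℕ) (hn : 1 ≤ n) (K : Set (OrliczLegendre.Euc n))
    (hK : OrliczLegendre.IsStarBody K) (φ : ℝ → ℝ) (hφ : OrliczLegendre.MemPhi φ) :
    -- `L_{φ^p} K` is well defined for all real `p ≥ 1`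
    (∀ p : ℝ, 1 ≤ p →
      OrliczLegendre.IsUniqueVolumeMin
        (OrliczLegendre.orliczFeasible (fun t => φ t ^ p) K)
        (OrliczLegendre.orliczLegendre (fun t => φ t ^ p) K)) ∧
    -- `L_∞ K` is the unique origin-symmetric ellipsoid of minimal volume containing `K`
    OrliczLegendre.IsUniqueVolumeMin
      {E | OrliczLegendre.IsCenteredEllipsoid E ∧ K ⊆ E} (OrliczLegendre.legendreInfty K) ∧
    -- if `K` is origin-symmetric, it is the Löwner ellipsoid of `K`
    (-K = K →
      OrliczLegendre.IsUniqueVolumeMin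
        {E | OrliczLegendre.IsEllipsoid E ∧ K ⊆ E} (OrliczLegendre.legendreInfty K)) ∧
    -- convergence in the Hausdorff metric
    Tendsto (fun p : ℝ =>
        Metric.hausdorffDist (OrliczLegendre.orliczLegendre (fun t => φ t ^ p) K)
          (OrliczLegendre.legendreInfty K)) atTop (𝓝 0) ∧
    -- convergence in the dual Hausdorff metric
    Tendsto (fun p : ℝ =>
        OrliczLegendre.dualHausdorffDist (OrliczLegendre.orliczLegendre (fun t => φ t ^ p) K)
          (OrliczLegendre.legendreInfty K)) atTop (𝓝 0) := by
  have := hK.isFiniteMeasure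
  have := hK.isOpenPosMeasure hn
  have hx := hK.continuous_boundaryPoint
  have hs := hK.spanning
  obtain ⟨A, hA, hAp, hAmax⟩ := exists_feasibleInfty_max (μ := dualConicalMeasure K) hx hs
  have hmax : ∀ p : ℝ, ∃ B : Matrix (Fin n) (Fin n) ℝ, 1 ≤ p →
      B ∈ feasible (fun t => φ t ^ p) (dualConicalMeasure K) (boundaryPoint K) ∧ B.PosDef ∧
      ∀ C ∈ feasible (fun t => φ t ^ p) (dualConicalMeasure K) (boundaryPoint K),
        C ≠ B → C.det < B.det := by
    intro p
    by_cases hp : 1 ≤ p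
    · obtain ⟨B, h1, h2, h3⟩ :=
        (hφ.rpow hp).exists_feasible_max (μ := dualConicalMeasure K) hx hs
      exact ⟨B, fun _ => ⟨h1, h2, h3⟩⟩
    · exact ⟨0, fun h => absurd h hp⟩
  choose f hf using hmax
  have hmin : ∀ p : ℝ, 1 ≤ p →
      IsUniqueVolumeMin (orliczFeasible (fun t => φ t ^ p) K) (ellipsoid (f p)) := by
    intro p hp
    refine isUniqueVolumeMin_ellipsoid (fun E hE => hE.1) (fun B hB => ?_) (hf p hp).2.1
      (hf p hp).1 (hf p hp).2.2
    refine ⟨fun h => ⟨hB.posSemidef,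
        ((hφ.rpow hp).orliczO_ellipsoid_le_one_iff hK hn hB).1 h.2⟩,
      fun h => ⟨isCenteredEllipsoid_ellipsoid hB,
        ((hφ.rpow hp).orliczO_ellipsoid_le_one_iff hK hn hB).2 h.2⟩⟩
  have heq : ∀ p : ℝ, 1 ≤ p → orliczLegendre (fun t => φ t ^ p) K = ellipsoid (f p) :=
    fun p hp => (Classical.epsilon_spec (p := IsUniqueVolumeMin
      (orliczFeasible (fun t => φ t ^ p) K)) ⟨_, hmin p hp⟩).eq (hmin p hp)
  have hinf : legendreInfty K = ellipsoid A :=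
    legendreInfty_eq hAp ((hK.subset_ellipsoid_iff A).2 hA.2) fun B hB hKB =>
      hAmax B ⟨hB.posSemidef, (hK.subset_ellipsoid_iff B).1 hKB⟩
  have hinfmin : IsUniqueVolumeMin {E | IsCenteredEllipsoid E ∧ K ⊆ E} (legendreInfty K) := by
    rw [hinf]
    refine isUniqueVolumeMin_ellipsoid (fun E hE => hE.1) (fun B hB => ?_) hAp hA hAmax
    exact ⟨fun h => ⟨hB.posSemidef, (hK.subset_ellipsoid_iff B).1 h.2⟩,
      fun h => ⟨isCenteredEllipsoid_ellipsoid hB, (hK.subset_ellipsoid_iff B).2 h.2⟩⟩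
  have hlim : Tendsto f atTop (𝓝 A) := hφ.tendsto_feasible_max (μ := dualConicalMeasure K) hx hs
    (fun p hp => (hf p hp).1) (fun p hp => (hf p hp).2.2) hA hAmax
  have hpd : ∀ᶠ p in atTop, (f p).PosDef := by
    filter_upwards [eventually_ge_atTop 1] with p hp using (hf p hp).2.1
  refine ⟨fun p hp => ?_, hinfmin, fun hsym => hinfmin.of_neg_eq hn hsym, ?_, ?_⟩
  · rw [heq p hp]; exact hmin p hp
  · refine (tendsto_hausdorffDist_ellipsoid hAp hpd hlim).congr' ?_
    filter_upwards [eventually_ge_atTop 1] with p hp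
    rw [heq p hp, hinf]
  · refine (tendsto_dualHausdorffDist_ellipsoid hAp hpd hlim).congr' ?_
    filter_upwards [eventually_ge_atTop 1] with p hp
    rw [heq p hp, hinf]
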